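/- Let $f$ be a non-constant entire function of finite order, i.e. $f(z)=O(e^{|z|^{\rho}})$ as $|z|\to\infty$ for some real $\rho$. For $z\in\mathbb{C}$ let $\phi_{0n}(z)$ denote the values at $z$ of the automorphic functions of $f$ (the solutions of $f(\phi(z))=f(z)$); that is, $(\phi_{0n}(z))_n$ is any enumeration of the (finitely or infinitely many) zeros of the entire function $w\mapsto f(w)-f(z)$, each listed according to its multiplicity. Put $Q_\lambda(u)=\sum_{k=1}^{\lambda}u^k/k$ (so $Q_0=0$) and $D=f(\mathbb{C})\setminus\{f(0)\}$. Then there is a single integer $\lambda\ge 0$, depending only on $f$, such that for every $z$ with $f(z)\neq f(0)$ the product below converges unconditionally and locally uniformly in $w\in\mathbb{C}$, and $$f(w)-f(z)=\exp\bigl(F(w,f(z))\bigr)\prod_{n}\Bigl(1-\frac{w}{\phi_{0n}(z)}\Bigr)e^{Q_\lambda(w/\phi_{0n}(z))}\qquad(w\in\mathbb{C}).$$ Here $F$ is a holomorphic function on $\mathbb{C}\times D$, in general multivalued and determined up to integer multiples of $2\pi i$: $\exp F$ is a single-valued zero-free holomorphic function on $\mathbb{C}\times D$, and for every simply connected open set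 $U\subseteq D$ there is a single-valued holomorphic function $F$ on $\mathbb{C}\times U$ with this exponential. In particular, the canonical product is a holomorphic function of $(w,f(z))$: there is a holomorphic function $P$ on $\mathbb{C}\times D$ whose value at $(w,f(z))$ is the product, for all $w\in\mathbb{C}$ and all $z$ with $f(z)\ne f(0)$. -/

import Mathlib

open Set Filter Topology Asymptotics

/-- An entire function `f` has finite order: there is a real `ρ` with
`f z = O(exp (|z| ^ ρ))` as `|z| → ∞`. -/
def HasFiniteOrder (f : ℂ → ℂ) : Prop :=
  ∃ ρ : ℝ, f =O[cocompact ℂ] fun z : ℂ => Real.exp (‖z‖ ^ ρ)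

/-- The polynomial `Q_m(u) = u + u² / 2 + ⋯ + u ^ m / m` (so `Q_0 = 0`). -/
noncomputable def weierstrassQ (m : ℕ) (u : ℂ) : ℂ :=
  ∑ k ∈ Finset.Icc 1 m, u ^ k / (k : ℂ)

/-- The Weierstrass primary factor `E(u, m) = (1 - u) exp (Q_m(u))`. -/
noncomputable def weierstrassE (m : ℕ) (u : ℂ) : ℂ :=
  (1 - u) * Complex.exp (weierstrassQ m u)

/-- `φ n` (`n : ι`) is a complete system of automorphic functions of `f` on the set `Ω`: each
`φ n` solves the automorphic equation `f (φ n z) = f z` on `Ω`, and for every `z ∈ Ω` the values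
`φ n z` run over the zeros of `w ↦ f w - f z`, each zero `a` being listed as many times as its
multiplicity. No regularity in `z` is imposed (in general the automorphic functions are
multivalued and have to be cut into branches); `Ω` may be a single point. -/
structure IsAutomorphicSystem {ι : Type} (f : ℂ → ℂ) (Ω : Set ℂ) (φ : ι → ℂ → ℂ) : Prop where
  automorphic : ∀ n, ∀ z ∈ Ω, f (φ n z) = f z
  complete : ∀ z ∈ Ω, ∀ a : ℂ,
    {n : ι | φ n z = a}.encard = analyticOrderAt (fun w => f w - f z) a

/-! For each value `c ≠ f 0` this is Hadamard's factorization of `h = f - c`; the point is to make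
the genus independent of `c` and the exponent holomorphic in `c`. Subtracting `c` changes only the
constant in the growth bound, not the power `N` of the radius (`HasFiniteOrder.exists_norm_sub_le`).
Zero counting then makes `∑ |a n|⁻¹ ^ (N + 2)` converge for every `c`, so `m = N + 2` serves
throughout. With genus `m`, the logarithm of the canonical product vanishes at the origin to order
greater than `m` (`exists_log_canonicalProduct`). A polynomial exponent of degree at most `m` with
no constant term must therefore be read off the Taylor coefficients of `h' / h` at `0`: this is
`hadamardExponent`, whose coefficients are holomorphic in `c ≠ f 0`. That the exponent is such a
polynomial (`hadamard_factorization`) follows by letting `R → ∞` in local factorizations on discs of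
radius `R / 2`. Their exponents have Taylor coefficients independent of `R`, while
Borel–Carathéodory forces those of order above `m` to be `O(1 / R)`. Finally `exp F (w, c) = (f 0 -
c) * exp (X (w, c))` with `X` this exponent, so multivaluedness comes only from `log (f 0 - c)`, and
the product is the quotient `(f w - c) / exp F`. -/

/-- The logarithm `log (1 - u) + Q_m(u)` of the Weierstrass primary factor near the origin. -/
noncomputable def weierstrassLogE (m : ℕ) (u : ℂ) : ℂ :=
  Complex.log (1 - u) + weierstrassQ m u

lemma differentiable_weierstrassQ (m : ℕ) : Differentiable ℂ (weierstrassQ m) := by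
  unfold weierstrassQ
  fun_prop

lemma differentiable_weierstrassE (m : ℕ) : Differentiable ℂ (weierstrassE m) := by
  have := differentiable_weierstrassQ m
  unfold weierstrassE
  fun_prop

lemma weierstrassQ_zero (m : ℕ) : weierstrassQ m 0 = 0 := by
  unfold weierstrassQ
  refine Finset.sum_eq_zero fun k hk => ?_
  have : k ≠ 0 := by have := (Finset.mem_Icc.1 hk).1; omega
  simp [this]

lemma weierstrassLogE_zero (m : ℕ) : weierstrassLogE m 0 = 0 := by
  simp [weierstrassLogE, weierstrassQ_zero]

lemma exp_weierstrassLogE (m : ℕ) {u : ℂ} (hu : ‖u‖ < 1) :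
    Complex.exp (weierstrassLogE m u) = weierstrassE m u := by
  have : 1 - u ≠ 0 := by
    intro h
    have : u = 1 := by linear_combination -h
    simp [this] at hu
  rw [weierstrassLogE, Complex.exp_add, Complex.exp_log this, weierstrassE]

lemma weierstrassQ_eq_neg_logTaylor (m : ℕ) (u : ℂ) :
    weierstrassQ m u = -Complex.logTaylor (m + 1) (-u) := by
  unfold weierstrassQ Complex.logTaylor
  rw [← Finset.sum_neg_distrib, Finset.sum_range_succ', ← Finset.Ico_add_one_right_eq_Icc,
    Finset.sum_Ico_eq_sum_range]
  simp only [Nat.cast_zero, div_zero, neg_zero, add_zero]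
  refine Finset.sum_congr (by simp) fun k _ => ?_
  rw [neg_pow u, add_comm 1 k]
  have : ((-1 : ℂ) ^ (k + 1 + 1) * ((-1) ^ (k + 1))) = -1 := by
    rw [← pow_add]; exact Odd.neg_one_pow ⟨k + 1, by ring⟩
  rw [← mul_assoc, this]
  ring

/-- `Q_m` cancels the Taylor polynomial of `log (1 - u)` of degree `m`, so only the remainder is
left. -/
lemma norm_weierstrassLogE_le (m : ℕ) {u : ℂ} (hu : ‖u‖ ≤ 1 / 2) :
    ‖weierstrassLogE m u‖ ≤ 2 * ‖u‖ ^ (m + 1) := by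
  have h := Complex.norm_log_sub_logTaylor_le m (z := -u) (by rw [norm_neg]; linarith)
  rw [norm_neg, ← sub_eq_add_neg] at h
  rw [weierstrassLogE, weierstrassQ_eq_neg_logTaylor, ← sub_eq_add_neg]
  refine h.trans ?_
  have h1 : (1 - ‖u‖)⁻¹ ≤ 2 := by
    rw [inv_le_comm₀ (by linarith) two_pos]; linarith
  have h2 : ‖u‖ ^ (m + 1) * (1 - ‖u‖)⁻¹ ≤ 2 * ‖u‖ ^ (m + 1) := by
    rw [mul_comm]; gcongr
  refine (div_le_self (by have : 0 ≤ (1 - ‖u‖)⁻¹ := inv_nonneg.2 (by linarith)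
                          positivity) ?_).trans h2
  have : (0 : ℝ) ≤ m := by positivity
  linarith

lemma norm_weierstrassE_sub_one_le (m : ℕ) {u : ℂ} (hu : ‖u‖ ≤ 1 / 2) :
    ‖weierstrassE m u - 1‖ ≤ 4 * ‖u‖ ^ (m + 1) := by
  rw [← exp_weierstrassLogE m (by linarith : ‖u‖ < 1)]
  have h := norm_weierstrassLogE_le m hu
  have h1 : ‖u‖ ^ (m + 1) ≤ 1 / 2 := by
    rw [pow_succ]
    have : ‖u‖ ^ m ≤ 1 := pow_le_one₀ (norm_nonneg _) (by linarith)
    nlinarith [norm_nonneg u]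
  have h2 := Complex.norm_exp_sub_one_le (x := weierstrassLogE m u) (by linarith)
  linarith

lemma differentiableAt_weierstrassLogE (m : ℕ) {u : ℂ} (hu : ‖u‖ < 1) :
    DifferentiableAt ℂ (weierstrassLogE m) u := by
  have h1 : 1 - u ∈ Complex.slitPlane := by
    rw [sub_eq_add_neg]
    exact Complex.mem_slitPlane_of_norm_lt_one (by rwa [norm_neg])
  have h2 := (differentiable_weierstrassQ m).differentiableAt (x := u)
  have h3 : DifferentiableAt ℂ (fun u => Complex.log (1 - u)) u :=
    ((differentiableAt_const _).sub differentiableAt_id).clog h1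
  exact h3.add h2

/-! ### Convergence of canonical products and of their logarithms -/

section family

variable {ι : Type*} {a : ι → ℂ} {m : ℕ}

lemma norm_div_le_half {δ : ℝ} (hδ : 0 < δ) {b w : ℂ} (hb : δ ≤ ‖b‖) (hw : ‖w‖ ≤ δ / 2) :
    ‖w / b‖ ≤ 1 / 2 := by
  rw [norm_div, div_le_iff₀ (by linarith)]
  linarith

/-- The canonical product converges locally uniformly. -/
lemma hasProdLocallyUniformlyOn_weierstrassE
    (hs : Summable fun n => ‖a n‖⁻¹ ^ (m + 1)) (ha : ∀ R : ℝ, {n | ‖a n‖ ≤ R}.Finite) :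
    HasProdLocallyUniformlyOn (fun n w => weierstrassE m (w / a n))
      (fun w => ∏' n, weierstrassE m (w / a n)) univ := by
  refine hasProdLocallyUniformlyOn_of_of_forall_exists_nhds fun x _ => ?_
  set r : ℝ := ‖x‖ + 1 with hr
  have hr0 : 0 < r := by positivity
  refine ⟨Metric.ball 0 r, by
    rw [nhdsWithin_univ]; exact Metric.isOpen_ball.mem_nhds (by simp [hr]), ?_⟩
  have key : HasProdUniformlyOn (fun n w => 1 + (weierstrassE m (w / a n) - 1))
      (fun w => ∏' n, (1 + (weierstrassE m (w / a n) - 1))) (Metric.closedBall 0 r) := by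
    refine (hs.mul_left (4 * r ^ (m + 1))).hasProdUniformlyOn_one_add (isCompact_closedBall _ _)
      ?_ ?_
    -- Only finitely many indices have `‖a n‖ ≤ 2 * r`; for the others `w / a n` lies in the disc of
    -- radius `1 / 2`.
    · have hfin := (ha (2 * r)).eventually_cofinite_notMem
      filter_upwards [hfin] with n hn w hw
      have hn : 2 * r < ‖a n‖ := by simpa using hn
      have hw : ‖w‖ ≤ r := by simpa using hw
      have h1 : ‖w / a n‖ ≤ 1 / 2 := norm_div_le_half (δ := 2 * r) (by positivity) hn.le (by linarith)
      refine (norm_weierstrassE_sub_one_le m h1).trans ?_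
      rw [norm_div, div_eq_mul_inv, mul_pow, ← mul_assoc]
      gcongr
    · intro n
      have := differentiable_weierstrassE m
      have : Differentiable ℂ fun w => weierstrassE m (w / a n) - 1 := by
        refine Differentiable.sub_const (this.comp (differentiable_id.div_const _)) _
      exact this.continuous.continuousOn
  simp only [add_sub_cancel] at key
  exact key.mono Metric.ball_subset_closedBall

lemma summable_weierstrassLogE_bound
    (hs : Summable fun n => ‖a n‖⁻¹ ^ (m + 1)) (w : ℂ) :
    Summable fun n => 2 * ‖w / a n‖ ^ (m + 1) := by
  refine ((hs.mul_left (‖w‖ ^ (m + 1))).mul_left 2).congr fun n => ?_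
  rw [norm_div, div_eq_mul_inv, mul_pow]

lemma norm_tsum_weierstrassLogE_le {δ : ℝ} (hδ : 0 < δ) (ha : ∀ n, δ ≤ ‖a n‖)
    (hs : Summable fun n => ‖a n‖⁻¹ ^ (m + 1)) {w : ℂ} (hw : ‖w‖ ≤ δ / 2) :
    Summable (fun n => weierstrassLogE m (w / a n)) ∧
    ‖∑' n, weierstrassLogE m (w / a n)‖ ≤ ∑' n, 2 * ‖w / a n‖ ^ (m + 1) := by
  have hb := summable_weierstrassLogE_bound hs w
  have hle : ∀ n, ‖weierstrassLogE m (w / a n)‖ ≤ 2 * ‖w / a n‖ ^ (m + 1) := fun n =>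
    norm_weierstrassLogE_le m (norm_div_le_half hδ (ha n) hw)
  exact ⟨hb.of_norm_bounded hle, tsum_of_norm_bounded hb.hasSum hle⟩

lemma hasProd_weierstrassE_exp {δ : ℝ} (hδ : 0 < δ) (ha : ∀ n, δ ≤ ‖a n‖)
    (hs : Summable fun n => ‖a n‖⁻¹ ^ (m + 1)) {w : ℂ} (hw : ‖w‖ ≤ δ / 2) :
    HasProd (fun n => weierstrassE m (w / a n))
      (Complex.exp (∑' n, weierstrassLogE m (w / a n))) := by
  have h := (norm_tsum_weierstrassLogE_le hδ ha hs hw).1.hasSum.cexp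
  refine h.congr_fun ?_
  intro n
  exact (exp_weierstrassLogE m ((norm_div_le_half hδ (ha n) hw).trans_lt (by norm_num))).symm

lemma differentiableOn_tsum_weierstrassLogE {δ : ℝ} (hδ : 0 < δ) (ha : ∀ n, δ ≤ ‖a n‖)
    (hs : Summable fun n => ‖a n‖⁻¹ ^ (m + 1)) :
    DifferentiableOn ℂ (fun w => ∑' n, weierstrassLogE m (w / a n)) (Metric.ball 0 (δ / 2)) := by
  refine Complex.differentiableOn_tsum_of_summable_norm
    (hs.mul_left (2 * (δ / 2) ^ (m + 1))) (fun n w hw => ?_) Metric.isOpen_ball ?_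
  · have hw : ‖w‖ < δ / 2 := by simpa using hw
    have h := differentiableAt_weierstrassLogE m
      ((norm_div_le_half hδ (ha n) hw.le).trans_lt (by norm_num))
    exact (DifferentiableAt.fun_comp' w h (by fun_prop)).differentiableWithinAt
  · intro n w hw
    have hw : ‖w‖ < δ / 2 := by simpa using hw
    refine (norm_weierstrassLogE_le m (norm_div_le_half hδ (ha n) hw.le)).trans ?_
    rw [norm_div, div_eq_mul_inv, mul_pow, ← mul_assoc]
    gcongr

end family

/-! ### Division by finitely many zeros -/

section division

variable {ι : Type*} {a : ι → ℂ} {h : ℂ → ℂ}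

lemma exists_entire_eq_sub_mul (hh : Differentiable ℂ h) {b : ℂ} (hb : h b = 0) :
    ∃ g : ℂ → ℂ, Differentiable ℂ g ∧ ∀ w, h w = (w - b) * g w := by
  refine ⟨dslope h b, ?_, fun w => ?_⟩
  · rw [← differentiableOn_univ, Complex.differentiableOn_dslope univ_mem]
    exact hh.differentiableOn
  · have := sub_smul_dslope h b w
    simpa [hb] using this.symm

lemma analyticOrderAt_sub_mul {g : ℂ → ℂ} (hg : Differentiable ℂ g) (b z : ℂ) :
    analyticOrderAt (fun w => (w - b) * g w) z =
      (if z = b then 1 else 0) + analyticOrderAt g z := by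
  have := analyticOrderAt_mul (f := fun w => w - b) (g := g) (z₀ := z) (by fun_prop)
    (hg.analyticAt z)
  rw [← Pi.mul_def, this]
  split_ifs with hz
  · subst hz; simp
  · simp [hz]

/-- Dividing an entire function by finitely many of its zeros. -/
lemma exists_entire_eq_prod_mul (hh : Differentiable ℂ h)
    (S : Finset ι)
    (hS : ∀ b, ((S.filter fun n => a n = b).card : ℕ∞) ≤ analyticOrderAt h b) :
    ∃ g : ℂ → ℂ, Differentiable ℂ g ∧ (∀ w, h w = (∏ n ∈ S, (w - a n)) * g w) ∧
      ∀ b, analyticOrderAt h b = ((S.filter fun n => a n = b).card : ℕ∞) + analyticOrderAt g b := by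
  classical
  induction S using Finset.induction_on with
  | empty => exact ⟨h, hh, by simp, by simp⟩
  | insert n S hn ih =>
    obtain ⟨g, hg, hprod, hord⟩ := ih fun b =>
      le_trans (by gcongr; exact Finset.subset_insert _ _) (hS b)
    have hgz : g (a n) = 0 := by
      -- If `g (a n) ≠ 0`, the indices in `S` already exhaust the multiplicity of `a n`, leaving no
      -- room for the new index `n`.
      by_contra hne
      have h0 : analyticOrderAt g (a n) = 0 :=
        (hg.analyticAt _).analyticOrderAt_eq_zero.2 hne
      have h1 := hS (a n)
      rw [hord (a n), h0, add_zero, Finset.filter_insert, if_pos rfl,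
        Finset.card_insert_of_notMem (by simp [hn])] at h1
      norm_cast at h1
      omega
    obtain ⟨q, hq, hqe⟩ := exists_entire_eq_sub_mul hg hgz
    refine ⟨q, hq, fun w => ?_, fun b => ?_⟩
    · rw [hprod, hqe, Finset.prod_insert hn]; ring
    · rw [hord b, show g = fun w => (w - a n) * q w from funext hqe, analyticOrderAt_sub_mul hq,
        Finset.filter_insert]
      by_cases hb : a n = b
      · rw [if_pos hb.symm, if_pos hb, Finset.card_insert_of_notMem (by simp [hn])]
        push_cast
        ring
      · rw [if_neg hb, if_neg (Ne.symm hb)]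
        simp

end division

/-! ### Zero listings and counting of zeros -/

/-- `a` lists the zeros of the entire function `h`, with multiplicity. -/
structure IsZeroListing {ι : Type*} (h : ℂ → ℂ) (a : ι → ℂ) : Prop where
  differentiable : Differentiable ℂ h
  apply_zero_ne : h 0 ≠ 0
  encard_fiber : ∀ b, {n | a n = b}.encard = analyticOrderAt h b

namespace IsZeroListing

variable {ι : Type*} {a : ι → ℂ} {h : ℂ → ℂ}

lemma order_ne_top (H : IsZeroListing h a) (b : ℂ) : analyticOrderAt h b ≠ ⊤ := by
  have hA : AnalyticOnNhd ℂ h univ := fun z _ => H.differentiable.analyticAt z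
  refine hA.analyticOrderAt_ne_top_of_isPreconnected isPreconnected_univ (x := 0) (mem_univ _)
    (mem_univ _) ?_
  rw [(H.differentiable.analyticAt 0).analyticOrderAt_eq_zero.2 H.apply_zero_ne]
  simp

lemma apply_eq_zero (H : IsZeroListing h a) (n : ι) : h (a n) = 0 := by
  by_contra hne
  have h1 := H.encard_fiber (a n)
  rw [(H.differentiable.analyticAt _).analyticOrderAt_eq_zero.2 hne, encard_eq_zero] at h1
  have : n ∈ {k | a k = a n} := rfl
  rw [h1] at this
  exact this

lemma ne_zero (H : IsZeroListing h a) (n : ι) : a n ≠ 0 := fun h0 =>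
  H.apply_zero_ne (h0 ▸ H.apply_eq_zero n)

lemma finite_norm_le (H : IsZeroListing h a) (R : ℝ) : {n | ‖a n‖ ≤ R}.Finite := by
  have hA : AnalyticOnNhd ℂ h univ := fun z _ => H.differentiable.analyticAt z
  have hfin : ({z : ℂ | h z = 0} ∩ Metric.closedBall 0 R).Finite := by
    have hc := hA.preimage_zero_mem_codiscrete (x := 0) H.apply_zero_ne
    refine ((isCompact_closedBall (0 : ℂ) R).finite_sdiff_of_mem_codiscreteWithin
      (codiscreteWithin_mono (subset_univ _) hc)).subset ?_
    intro z hz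
    exact ⟨hz.2, by simpa using hz.1⟩
  have hsub : {n | ‖a n‖ ≤ R} ⊆ ⋃ b ∈ {z : ℂ | h z = 0} ∩ Metric.closedBall 0 R, {n | a n = b} := by
    intro n hn
    simp only [mem_iUnion, mem_ofPred_eq, exists_prop]
    exact ⟨a n, ⟨H.apply_eq_zero n, by simpa using hn⟩, rfl⟩
  refine (hfin.biUnion fun b _ => ?_).subset hsub
  rw [← encard_ne_top_iff, H.encard_fiber]
  exact H.order_ne_top b

/-- The finite set of indices of the zeros in a closed disc. -/
noncomputable def indices (H : IsZeroListing h a) (R : ℝ) : Finset ι :=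
  (H.finite_norm_le R).toFinset

lemma mem_indices (H : IsZeroListing h a) {R : ℝ} {n : ι} : n ∈ H.indices R ↔ ‖a n‖ ≤ R := by
  simp [indices]

lemma exists_delta (H : IsZeroListing h a) : ∃ δ > 0, ∀ n, δ ≤ ‖a n‖ := by
  have : ∀ᶠ z in 𝓝 (0 : ℂ), h z ≠ 0 :=
    H.differentiable.continuous.continuousAt.eventually_ne H.apply_zero_ne
  obtain ⟨δ, hδ, hb⟩ := Metric.eventually_nhds_iff.1 this
  refine ⟨δ, hδ, fun n => ?_⟩
  by_contra hlt
  exact hb (by simpa using hlt) (H.apply_eq_zero n)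

/-- Removing the zeros in a closed disc. -/
lemma exists_quotient (H : IsZeroListing h a) (R : ℝ) :
    ∃ g : ℂ → ℂ, Differentiable ℂ g ∧ g 0 = 1 ∧
      (∀ w, h w = h 0 * (∏ n ∈ H.indices R, (1 - w / a n)) * g w) ∧
      ∀ w, ‖w‖ ≤ R → g w ≠ 0 := by
  classical
  have hcard : ∀ b, (((H.indices R).filter fun n => a n = b).card : ℕ∞) =
      if ‖b‖ ≤ R then analyticOrderAt h b else 0 := by
    intro b
    split_ifs with hb
    · rw [← H.encard_fiber b, ← encard_coe_eq_coe_finsetCard]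
      congr 1
      ext n
      simp only [Finset.coe_filter, mem_ofPred_eq, mem_indices]
      exact ⟨fun h => h.2, fun h => ⟨h ▸ hb, h⟩⟩
    · rw [Finset.filter_eq_empty_iff.2]
      · simp
      · intro n hn hab
        exact hb (hab ▸ H.mem_indices.1 hn)
  obtain ⟨g, hg, hprod, hord⟩ := exists_entire_eq_prod_mul H.differentiable
    (a := a) (H.indices R) fun b => by
      rw [hcard]; split_ifs <;> simp
  have h0 := hprod 0
  have hP : (∏ n ∈ H.indices R, (0 - a n)) ≠ 0 :=
    Finset.prod_ne_zero_iff.2 fun n _ => by simpa using H.ne_zero n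
  have hg0 : g 0 ≠ 0 := fun hz => H.apply_zero_ne (by rw [h0, hz, mul_zero])
  refine ⟨fun w => g w / g 0, hg.div_const _, div_self hg0, fun w => ?_, fun w hw => ?_⟩
  · have : ∏ n ∈ H.indices R, (w - a n) =
        (∏ n ∈ H.indices R, (0 - a n)) * ∏ n ∈ H.indices R, (1 - w / a n) := by
      rw [← Finset.prod_mul_distrib]
      refine Finset.prod_congr rfl fun n _ => ?_
      field_simp [H.ne_zero n]
      ring
    rw [hprod w, h0, this]
    field_simp
  · refine div_ne_zero ?_ hg0
    rw [← (hg.analyticAt w).analyticOrderAt_eq_zero]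
    have h1 := hord w
    rw [hcard, if_pos hw] at h1
    have h2 := H.order_ne_top w
    generalize analyticOrderAt h w = x at h1 h2
    lift x to ℕ using h2
    generalize analyticOrderAt g w = y at h1
    cases y with
    | top => simp at h1
    | coe y => norm_cast at h1 ⊢; omega

/-- Maximum principle on the circle of radius `t R`, on which each removed factor has
modulus at least `t - 1`. -/
lemma norm_quotient_le (H : IsZeroListing h a) {R t B : ℝ} (hR : 0 < R) (ht : 1 < t)
    (hB : ∀ w, ‖w‖ ≤ t * R → ‖h w‖ ≤ B) {g : ℂ → ℂ} (hg : Differentiable ℂ g)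
    (hprod : ∀ w, h w = h 0 * (∏ n ∈ H.indices R, (1 - w / a n)) * g w)
    {w : ℂ} (hw : ‖w‖ ≤ t * R) :
    (t - 1) ^ (H.indices R).card * ‖g w‖ ≤ B / ‖h 0‖ := by
  have hh0 : 0 < ‖h 0‖ := norm_pos_iff.2 H.apply_zero_ne
  have htp : 0 < (t - 1) ^ (H.indices R).card := pow_pos (by linarith) _
  rw [mul_comm, ← le_div_iff₀ htp]
  have htR : t * R ≠ 0 := by positivity
  refine Complex.norm_le_of_forall_mem_frontier_norm_le (U := Metric.ball (0 : ℂ) (t * R))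
    Metric.isBounded_ball hg.diffContOnCl (fun z hz => ?_)
    (by rw [closure_ball _ htR]; simpa using hw)
  rw [frontier_ball _ htR, mem_sphere_zero_iff_norm] at hz
  rw [le_div_iff₀ htp, le_div_iff₀ hh0]
  refine le_trans ?_ (hB z hz.le)
  rw [hprod z, norm_mul, norm_mul, norm_prod, mul_comm, mul_comm ‖g z‖, ← mul_assoc]
  gcongr
  rw [← Finset.prod_const]
  refine Finset.prod_le_prod (fun _ _ => by linarith) fun n hn => ?_
  have han : 0 < ‖a n‖ := norm_pos_iff.2 (H.ne_zero n)
  have h1 : t ≤ ‖z / a n‖ := by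
    rw [norm_div, hz, le_div_iff₀ han]
    have := H.mem_indices.1 hn
    gcongr
  have h2 := norm_sub_norm_le (z / a n) 1
  rw [norm_one] at h2
  rw [norm_sub_rev]
  linarith

/-- A substitute for Jensen's formula: the maximum principle with `t = 3`, evaluated at the origin,
where the quotient equals `1`. -/
lemma two_pow_card_le (H : IsZeroListing h a) {R B : ℝ} (hR : 0 < R)
    (hB : ∀ w, ‖w‖ ≤ 3 * R → ‖h w‖ ≤ B) : 2 ^ (H.indices R).card ≤ B / ‖h 0‖ := by
  obtain ⟨g, hg, hg0, hprod, -⟩ := H.exists_quotient R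
  have := H.norm_quotient_le hR (by norm_num) hB hg hprod (w := 0) (by simpa using hR.le)
  rw [hg0] at this
  norm_num at this
  exact this

lemma card_indices_le (H : IsZeroListing h a) {N : ℕ} {A : ℝ}
    (hA : ∀ R : ℝ, 1 ≤ R → ∀ w, ‖w‖ ≤ R → ‖h w‖ ≤ Real.exp (A * R ^ N)) :
    ∃ C : ℝ, 0 ≤ C ∧ ∀ R : ℝ, 1 ≤ R → ((H.indices R).card : ℝ) ≤ C * R ^ N := by
  have hh0 : 0 < ‖h 0‖ := norm_pos_iff.2 H.apply_zero_ne
  -- The factor `2` makes up for dividing by `log 2 > 1 / 2`; `3 ^ N` comes from using the growth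
  -- bound at radius `3 * R`.
  refine ⟨2 * (|A| * 3 ^ N + |Real.log ‖h 0‖|), by positivity, fun R hR => ?_⟩
  have h1 := H.two_pow_card_le (by linarith) (hA (3 * R) (by linarith))
  have h2 := Real.log_le_log (by positivity) h1
  rw [Real.log_pow, Real.log_div (Real.exp_pos _).ne' hh0.ne', Real.log_exp] at h2
  have hRN : 1 ≤ R ^ N := one_le_pow₀ hR
  have h3 : A * (3 * R) ^ N ≤ |A| * 3 ^ N * R ^ N := by
    rw [mul_pow, ← mul_assoc]
    gcongr
    exact le_abs_self A
  have h4 : -Real.log ‖h 0‖ ≤ |Real.log ‖h 0‖| * R ^ N :=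
    (neg_le_abs _).trans (le_mul_of_one_le_right (abs_nonneg _) hRN)
  have h5 := Real.log_two_gt_d9
  have h6 : (0 : ℝ) ≤ (H.indices R).card := by positivity
  nlinarith

/-- The zeros have finite exponent of convergence. -/
lemma summable_inv_pow (H : IsZeroListing h a) {N : ℕ} {A : ℝ}
    (hA : ∀ R : ℝ, 1 ≤ R → ∀ w, ‖w‖ ≤ R → ‖h w‖ ≤ Real.exp (A * R ^ N)) :
    Summable fun n => ‖a n‖⁻¹ ^ (N + 2) := by
  classical
  obtain ⟨C, hC0, hC⟩ := H.card_indices_le hA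
  obtain ⟨δ, hδ, hδa⟩ := H.exists_delta
  set K : ℝ := 1 + δ⁻¹ with hK
  have hK0 : 0 < K := by positivity
  have hsum : Summable fun j : ℕ => ((j : ℝ) ^ 2)⁻¹ := by
    exact Real.summable_nat_pow_inv.2 one_lt_two
  -- The zeros are grouped into unit shells. Shell `j` has at most `C * j ^ N` zeros, each
  -- contributing `O(j⁻¹ ^ (N + 2))`, so the shell sums are dominated by `∑ j⁻²`. The constant `K`
  -- absorbs the rounding, since `‖a n‖ + 1 ≤ K * ‖a n‖`.
  let κ : ι → ℕ := fun n => ⌈‖a n‖⌉₊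
  have hpos : ∀ n, 0 < ‖a n‖ := fun n => norm_pos_iff.2 (H.ne_zero n)
  have hκ : ∀ n, ‖a n‖⁻¹ ≤ K * (κ n : ℝ)⁻¹ := by
    intro n
    have h1 : (κ n : ℝ) < ‖a n‖ + 1 := Nat.ceil_lt_add_one (hpos n).le
    have h2 : 0 < (κ n : ℝ) := by exact_mod_cast Nat.ceil_pos.2 (hpos n)
    have h3 : 1 ≤ δ⁻¹ * ‖a n‖ := by
      rw [inv_mul_eq_div, one_le_div hδ]; exact hδa n
    rw [← div_eq_mul_inv, inv_eq_one_div, div_le_div_iff₀ (hpos n) h2]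
    nlinarith
  refine summable_of_sum_le (c := C * K ^ (N + 2) * ∑' j : ℕ, ((j : ℝ) ^ 2)⁻¹)
    (fun n => by positivity) fun F => ?_
  calc ∑ n ∈ F, ‖a n‖⁻¹ ^ (N + 2)
      ≤ ∑ n ∈ F, (K * (κ n : ℝ)⁻¹) ^ (N + 2) := by
        gcongr with n _
        exact hκ n
    _ = ∑ j ∈ F.image κ, (F.filter fun n => κ n = j).card • (K * (j : ℝ)⁻¹) ^ (N + 2) :=
        Finset.sum_comp (fun j : ℕ => (K * (j : ℝ)⁻¹) ^ (N + 2)) κ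
    _ ≤ ∑ j ∈ F.image κ, C * K ^ (N + 2) * ((j : ℝ) ^ 2)⁻¹ := by
        refine Finset.sum_le_sum fun j hj => ?_
        obtain ⟨n₀, -, rfl⟩ := Finset.mem_image.1 hj
        have hj1 : 1 ≤ κ n₀ := Nat.ceil_pos.2 (hpos n₀)
        generalize κ n₀ = j at hj1
        have hj1' : (1 : ℝ) ≤ j := by exact_mod_cast hj1
        have hsub : (F.filter fun n => κ n = j) ⊆ H.indices j := by
          intro n hn
          rw [H.mem_indices, ← (Finset.mem_filter.1 hn).2]
          exact Nat.le_ceil _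
        have hcard : ((F.filter fun n => κ n = j).card : ℝ) ≤ C * (j : ℝ) ^ N :=
          le_trans (by exact_mod_cast Finset.card_le_card hsub) (hC j hj1')
        rw [nsmul_eq_mul]
        calc _ ≤ C * (j : ℝ) ^ N * (K * (j : ℝ)⁻¹) ^ (N + 2) := by gcongr
          _ = C * K ^ (N + 2) * ((j : ℝ) ^ 2)⁻¹ := by
            have : (j : ℝ) ≠ 0 := by positivity
            rw [mul_pow, inv_pow, pow_add (j : ℝ)]
            field_simp
    _ = C * K ^ (N + 2) * ∑ j ∈ F.image κ, ((j : ℝ) ^ 2)⁻¹ := by rw [Finset.mul_sum]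
    _ ≤ C * K ^ (N + 2) * ∑' j : ℕ, ((j : ℝ) ^ 2)⁻¹ := by
        gcongr
        exact hsum.sum_le_tsum _ fun j _ => by positivity

end IsZeroListing

/-! ### Holomorphic logarithms and coefficient estimates -/

/-- A continuous branch of the logarithm of a holomorphic function is holomorphic. -/
lemma differentiableOn_of_exp_eq {U : Set ℂ} (hU : IsOpen U) {f g : ℂ → ℂ}
    (hf : ContinuousOn f U) (hg : DifferentiableOn ℂ g U) (hfg : ∀ z ∈ U, Complex.exp (f z) = g z) :
    DifferentiableOn ℂ f U := by
  intro z hz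
  have hUz := hU.mem_nhds hz
  have hgz : g z ≠ 0 := hfg z hz ▸ Complex.exp_ne_zero _
  have hfc : ContinuousAt f z := hf.continuousAt hUz
  have hgd : DifferentiableAt ℂ g z := hg.differentiableAt hUz
  -- This keeps the imaginary part of `f w - f z` inside `(-π, π)`, where the principal logarithm
  -- inverts `exp`.
  have him : ∀ᶠ w in 𝓝 z, ‖f w - f z‖ < 1 := by
    have : ContinuousAt (fun w => ‖f w - f z‖) z := (hfc.sub continuousAt_const).norm
    exact this.eventually_lt continuousAt_const (by simp)
  have heq : f =ᶠ[𝓝 z] fun w => f z + Complex.log (g w / g z) := by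
    filter_upwards [him, hUz] with w hw hwU
    have h1 : g w / g z = Complex.exp (f w - f z) := by
      rw [Complex.exp_sub, hfg w hwU, hfg z hz]
    have h2 := (Complex.abs_im_le_norm (f w - f z)).trans_lt hw
    rw [abs_lt] at h2
    have := Real.pi_gt_three
    rw [h1, Complex.log_exp (by linarith) (by linarith)]
    ring
  refine DifferentiableAt.differentiableWithinAt ?_
  refine DifferentiableAt.congr_of_eventuallyEq ?_ heq
  refine (differentiableAt_const _).add ((hgd.div_const _).clog ?_)
  rw [div_self hgz]
  exact Complex.one_mem_slitPlane

lemma exists_differentiableOn_log {U : Set ℂ} (hU : IsOpen U) (hUc : IsSimplyConnected U)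
    {g : ℂ → ℂ} (hg : DifferentiableOn ℂ g U) (hne : ∀ z ∈ U, g z ≠ 0) :
    ∃ f : ℂ → ℂ, DifferentiableOn ℂ f U ∧ ∀ z ∈ U, Complex.exp (f z) = g z := by
  obtain ⟨f, hf, hfg⟩ := Complex.exists_continuousOn_eqOn_exp_comp hUc hU hg.continuousOn
    (by rintro ⟨z, hz, h0⟩; exact hne z hz h0)
  exact ⟨f, differentiableOn_of_exp_eq hU hf hg hfg, hfg⟩

lemma exists_log_on_ball {g : ℂ → ℂ} {R : ℝ} (hR : 0 < R)
    (hg : DifferentiableOn ℂ g (Metric.ball 0 R)) (hne : ∀ z ∈ Metric.ball 0 R, g z ≠ 0)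
    (hg0 : g 0 = 1) :
    ∃ M : ℂ → ℂ, DifferentiableOn ℂ M (Metric.ball 0 R) ∧ M 0 = 0 ∧
      ∀ z ∈ Metric.ball 0 R, Complex.exp (M z) = g z := by
  have : ContractibleSpace (Metric.ball (0 : ℂ) R) :=
    (convex_ball (0 : ℂ) R).contractibleSpace ⟨0, Metric.mem_ball_self hR⟩
  have hsc : IsSimplyConnected (Metric.ball (0 : ℂ) R) :=
    SimplyConnectedSpace.ofContractible _
  obtain ⟨f, hf, hfg⟩ := exists_differentiableOn_log Metric.isOpen_ball hsc hg hne
  refine ⟨fun z => f z - f 0, hf.sub_const _, sub_self _, fun z hz => ?_⟩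
  rw [Complex.exp_sub, hfg z hz, hfg 0 (Metric.mem_ball_self hR), hg0, div_one]

/-- Bound for the Taylor coefficients of a function with real part bounded above. -/
lemma norm_iteratedDeriv_le_of_re_le {L : ℂ → ℂ} {r B : ℝ} (hr : 0 < r) (hB : 0 < B)
    (hL : DifferentiableOn ℂ L (Metric.ball 0 r)) (hL0 : L 0 = 0)
    (hre : ∀ z ∈ Metric.ball 0 r, (L z).re ≤ B) (k : ℕ) :
    ‖iteratedDeriv k L 0‖ ≤ k.factorial * (2 * B) / (r / 2) ^ k := by
  refine Complex.norm_iteratedDeriv_le_of_forall_mem_sphere_norm_le k (by positivity)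
    ((hL.mono ?_).diffContOnCl_ball subset_rfl) fun z hz => ?_
  · exact Metric.closedBall_subset_ball (by linarith)
  · rw [mem_sphere_zero_iff_norm] at hz
    have := Complex.borelCaratheodory_zero hB hL (fun z hz => hre z hz) hr
      (z := z) (by simp [hz, hr]) hL0
    rw [hz] at this
    refine this.trans (le_of_eq ?_)
    field_simp
    ring

lemma nonpos_of_forall_le_div {x C : ℝ} (h : ∀ R : ℝ, 1 ≤ R → x ≤ C / R) : x ≤ 0 := by
  have ht : Tendsto (fun R : ℝ => C / R) atTop (𝓝 0) := tendsto_const_nhds.div_atTop tendsto_id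
  exact ge_of_tendsto ht ((eventually_ge_atTop 1).mono h)

lemma iteratedDeriv_weierstrassQ_eq_zero {m k : ℕ} (hk : m < k) (b : ℂ) :
    iteratedDeriv k (fun w => weierstrassQ m (w / b)) 0 = 0 := by
  unfold weierstrassQ
  rw [iteratedDeriv_fun_sum fun i _ => by fun_prop]
  refine Finset.sum_eq_zero fun i hi => ?_
  have hik : k ≠ i := by have := (Finset.mem_Icc.1 hi).2; omega
  have : (fun w : ℂ => (w / b) ^ i / (i : ℂ)) = fun w => (b ^ i * i)⁻¹ * w ^ i := by
    ext w
    rw [div_pow, div_div, div_eq_inv_mul]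
  rw [this, iteratedDeriv_const_mul_field, iteratedDeriv_fun_pow_zero, if_neg hik]
  simp

/-! ### Local factorization and the logarithm of the product at the origin -/

namespace IsZeroListing

variable {ι : Type*} {a : ι → ℂ} {h : ℂ → ℂ}

lemma summable_inv_pow_succ (H : IsZeroListing h a) {m : ℕ}
    (hs : Summable fun n => ‖a n‖⁻¹ ^ m) : Summable fun n => ‖a n‖⁻¹ ^ (m + 1) := by
  obtain ⟨δ, hδ, hδa⟩ := H.exists_delta
  refine (hs.mul_right δ⁻¹).of_nonneg_of_le (fun n => by positivity) fun n => ?_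
  rw [pow_succ]
  gcongr
  exact hδa n

/-- The local form of the factorization on a disc. -/
lemma exists_local_factorization (H : IsZeroListing h a) {m : ℕ}
    (hs : Summable fun n => ‖a n‖⁻¹ ^ m) {R B : ℝ} (hR : 0 < R)
    (hB : ∀ w, ‖w‖ ≤ 2 * R → ‖h w‖ / ‖h 0‖ ≤ Real.exp B) :
    ∃ L : ℂ → ℂ, DifferentiableOn ℂ L (Metric.ball 0 (R / 2)) ∧ L 0 = 0 ∧
      (∀ w ∈ Metric.ball 0 (R / 2), (L w).re ≤ B + R ^ m * ∑' n, ‖a n‖⁻¹ ^ m) ∧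
      ∀ w ∈ Metric.ball 0 (R / 2), h w = h 0 *
        Complex.exp (L w - ∑ n ∈ H.indices R, weierstrassQ m (w / a n)) *
          ∏' n, weierstrassE m (w / a n) := by
  have hs' := H.summable_inv_pow_succ hs
  obtain ⟨g, hg, hg0, hprod, hgne⟩ := H.exists_quotient R
  obtain ⟨M, hM, hM0, hMg⟩ := exists_log_on_ball hR hg.differentiableOn
    (fun z hz => hgne z (by simpa using (mem_ball_zero_iff.1 hz).le)) hg0
  set S : Set ι := ↑(H.indices R)
  let b : (Sᶜ : Set ι) → ℂ := fun n => a n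
  have hb : ∀ n, R ≤ ‖b n‖ := fun n => by
    have hn : (n : ι) ∉ H.indices R := n.2
    rw [H.mem_indices, not_le] at hn
    exact hn.le
  have hbs : Summable fun n => ‖b n‖⁻¹ ^ (m + 1) := hs'.subtype Sᶜ
  have hsub : Metric.ball (0 : ℂ) (R / 2) ⊆ Metric.ball 0 R :=
    Metric.ball_subset_ball (by linarith)
  refine ⟨fun w => M w - ∑' n, weierstrassLogE m (w / b n),
    (hM.mono hsub).sub (differentiableOn_tsum_weierstrassLogE hR hb hbs), ?_, ?_, ?_⟩
  · simp [hM0, weierstrassLogE_zero]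
  · intro w hw
    have hw' : ‖w‖ < R / 2 := mem_ball_zero_iff.1 hw
    have h1 : (M w).re ≤ B := by
      rw [← Real.exp_le_exp, ← Complex.norm_exp, hMg w (hsub hw)]
      have hBe : ∀ w, ‖w‖ ≤ 2 * R → ‖h w‖ ≤ Real.exp B * ‖h 0‖ := fun w hw =>
        (div_le_iff₀ (norm_pos_iff.2 H.apply_zero_ne)).1 (hB w hw)
      have := H.norm_quotient_le hR one_lt_two hBe hg hprod (w := w) (by linarith)
      rw [mul_div_cancel_right₀ _ (norm_ne_zero_iff.2 H.apply_zero_ne)] at this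
      norm_num at this
      exact this
    have h2 := (norm_tsum_weierstrassLogE_le hR hb hbs hw'.le).2
    -- One factor `‖w / b n‖ ≤ 1 / 2` is spent on cancelling the `2`. This leaves growth `R ^ m`
    -- rather than `R ^ (m + 1)`, and is why summability is assumed at exponent `m`.
    have h3 : ∑' n, 2 * ‖w / b n‖ ^ (m + 1) ≤ ∑' n : (Sᶜ : Set ι), R ^ m * ‖a n‖⁻¹ ^ m := by
      refine Summable.tsum_le_tsum (fun n => ?_) (summable_weierstrassLogE_bound hbs w)
        ((hs.subtype Sᶜ).mul_left _)
      have h4 := norm_div_le_half hR (hb n) hw'.le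
      have h5 : ‖w / b n‖ ≤ R * ‖b n‖⁻¹ := by
        rw [norm_div, div_eq_mul_inv]; gcongr; linarith
      rw [← mul_pow, pow_succ]
      calc 2 * (‖w / b n‖ ^ m * ‖w / b n‖) ≤ 2 * (‖w / b n‖ ^ m * (1 / 2)) := by gcongr
        _ = ‖w / b n‖ ^ m := by ring
        _ ≤ _ := by gcongr
    have h4 : ∑' n : (Sᶜ : Set ι), R ^ m * ‖a n‖⁻¹ ^ m ≤ R ^ m * ∑' n, ‖a n‖⁻¹ ^ m := by
      rw [← tsum_mul_left]
      exact (hs.mul_left (R ^ m)).tsum_subtype_le _ _ fun n => by positivity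
    have h5 := (abs_le.1 (Complex.abs_re_le_norm (∑' n, weierstrassLogE m (w / b n)))).1
    rw [Complex.sub_re]
    linarith
  · intro w hw
    have hw' : ‖w‖ < R / 2 := mem_ball_zero_iff.1 hw
    have hP : HasProd (fun n => weierstrassE m (w / a n)) ((∏ n ∈ H.indices R,
        weierstrassE m (w / a n)) * Complex.exp (∑' n, weierstrassLogE m (w / b n))) :=
      HasProd.mul_compl (s := S) ((H.indices R).hasProd fun n => weierstrassE m (w / a n))
        (hasProd_weierstrassE_exp hR hb hbs hw'.le)
    rw [hP.tprod_eq, hprod w, ← hMg w (hsub hw)]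
    simp only [weierstrassE]
    rw [Finset.prod_mul_distrib, ← Complex.exp_sum, Complex.exp_sub, Complex.exp_sub]
    field_simp [Complex.exp_ne_zero]

/-- Near the origin the canonical product is the exponential of a function vanishing to order
greater than `m`. -/
lemma exists_log_canonicalProduct (H : IsZeroListing h a) {m : ℕ}
    (hs : Summable fun n => ‖a n‖⁻¹ ^ (m + 1)) :
    ∃ η : ℂ → ℂ, AnalyticAt ℂ η 0 ∧ (∀ k ≤ m, iteratedDeriv k η 0 = 0) ∧
      ∀ᶠ w in 𝓝 0, ∏' n, weierstrassE m (w / a n) = Complex.exp (η w) := by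
  obtain ⟨δ, hδ, hδa⟩ := H.exists_delta
  have hd := differentiableOn_tsum_weierstrassLogE hδ hδa hs
  have hball : Metric.ball (0 : ℂ) (δ / 2) ∈ 𝓝 0 := Metric.ball_mem_nhds _ (by positivity)
  refine ⟨_, hd.analyticAt hball, fun k hk => ?_, ?_⟩
  · set T : ℝ := ∑' n, 2 * ‖a n‖⁻¹ ^ (m + 1) with hT
    have hT0 : 0 ≤ T := tsum_nonneg fun n => by positivity
    set c : ℝ := min (δ / 4) 1 with hc
    have hc0 : 0 < c := by positivity
    rw [← norm_le_zero_iff]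
    refine nonpos_of_forall_le_div (C := k.factorial * T * c) fun R hR => ?_
    have hr0 : 0 < c / R := by positivity
    have hrc : c / R ≤ c := div_le_self hc0.le hR
    have hr1 : c / R ≤ 1 := hrc.trans (min_le_right _ _)
    have hrδ : c / R < δ / 2 := by
      have := hrc.trans (min_le_left _ _); linarith
    -- Cauchy's estimate on the shrinking circle of radius `c / R`: a sum of size `O((c / R) ^ (m +
    -- 1))` divided by `(c / R) ^ k` with `k ≤ m` still tends to `0`.
    have := Complex.norm_iteratedDeriv_le_of_forall_mem_sphere_norm_le (c := 0) (R := c / R)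
      (C := T * (c / R) ^ (m + 1)) (f := fun w => ∑' n, weierstrassLogE m (w / a n)) k hr0
      ((hd.mono (Metric.closedBall_subset_ball hrδ)).diffContOnCl_ball subset_rfl) fun z hz => by
        rw [mem_sphere_zero_iff_norm] at hz
        refine (norm_tsum_weierstrassLogE_le hδ hδa hs (hz.trans_le hrδ.le)).2.trans (le_of_eq ?_)
        rw [hT, ← tsum_mul_right]
        congr 1
        ext n
        rw [norm_div, hz, div_eq_mul_inv, mul_pow]
        ring
    refine this.trans ?_
    rw [div_le_iff₀ (by positivity)]
    have h1 : (c / R) ^ (m + 1) ≤ c / R * (c / R) ^ k := by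
      rw [pow_succ']
      gcongr ?_ * ?_
      exact pow_le_pow_of_le_one hr0.le hr1 hk
    calc (k.factorial : ℝ) * (T * (c / R) ^ (m + 1))
        ≤ k.factorial * (T * (c / R * (c / R) ^ k)) := by gcongr
      _ = _ := by ring
  · filter_upwards [hball] with w hw
    exact (hasProd_weierstrassE_exp hδ hδa hs (mem_ball_zero_iff.1 hw).le).tprod_eq

end IsZeroListing

/-! ### Hadamard factorization with explicit exponent -/

/-- The polynomial `∑ t_k w ^ k`, `1 ≤ k ≤ m`, where `k t_k` is the Taylor coefficient of order
`k - 1` at the origin of the logarithmic derivative of `h`. -/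
noncomputable def hadamardExponent (m : ℕ) (h : ℂ → ℂ) (w : ℂ) : ℂ :=
  ∑ k ∈ Finset.range m, ((k + 1).factorial : ℂ)⁻¹ * iteratedDeriv k (logDeriv h) 0 * w ^ (k + 1)

namespace IsZeroListing

variable {ι : Type*} {a : ι → ℂ} {h : ℂ → ℂ}

/-- **Hadamard factorization** of an entire function of finite order, with explicit exponent. -/
theorem hadamard_factorization (H : IsZeroListing h a) {m : ℕ} {B : ℝ} (hB0 : 0 ≤ B)
    (hs : Summable fun n => ‖a n‖⁻¹ ^ m)
    (hB : ∀ R : ℝ, 1 ≤ R → ∀ w, ‖w‖ ≤ R → ‖h w‖ ≤ Real.exp (B * R ^ m)) (w : ℂ) :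
    h w = h 0 * Complex.exp (hadamardExponent m h w) * ∏' n, weierstrassE m (w / a n) := by
  obtain ⟨η, hη, hηk, hηP⟩ := H.exists_log_canonicalProduct (H.summable_inv_pow_succ hs)
  set T : ℝ := ∑' n, ‖a n‖⁻¹ ^ m
  have hT0 : 0 ≤ T := tsum_nonneg fun n => by positivity
  set D : ℝ := B * 2 ^ m + |Real.log ‖h 0‖| + T + 1 with hD
  have hD0 : 0 < D := by positivity
  have hloc : ∀ R : ℝ, 1 ≤ R → ∃ L : ℂ → ℂ, DifferentiableOn ℂ L (Metric.ball 0 (R / 2)) ∧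
      L 0 = 0 ∧ (∀ w ∈ Metric.ball 0 (R / 2), (L w).re ≤ D * R ^ m) ∧
      ∀ w ∈ Metric.ball 0 (R / 2), h w = h 0 *
        Complex.exp (L w - ∑ n ∈ H.indices R, weierstrassQ m (w / a n)) *
          ∏' n, weierstrassE m (w / a n) := by
    intro R hR
    have hRm : 1 ≤ R ^ m := one_le_pow₀ hR
    have hh0 : 0 < ‖h 0‖ := norm_pos_iff.2 H.apply_zero_ne
    obtain ⟨L, hL, hL0, hre, hfac⟩ := H.exists_local_factorization hs
      (B := B * (2 * R) ^ m + |Real.log ‖h 0‖|) (by linarith : 0 < R) fun w hw => by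
        rw [div_le_iff₀ hh0]
        refine (hB (2 * R) (by linarith) w hw).trans ?_
        nth_rw 2 [← Real.exp_log hh0]
        rw [← Real.exp_add, Real.exp_le_exp]
        linarith [neg_abs_le (Real.log ‖h 0‖)]
    refine ⟨L, hL, hL0, fun w hw => (hre w hw).trans ?_, hfac⟩
    have := mul_le_mul_of_nonneg_left hRm (abs_nonneg (Real.log ‖h 0‖))
    rw [hD, mul_pow]
    nlinarith
  -- Taking logarithmic derivatives near `0` expresses the coefficients of the local exponent
  -- through `h` and `η` alone, hence independently of `R` and `L`.
  have hcoef : ∀ R : ℝ, 1 ≤ R → ∀ L : ℂ → ℂ, DifferentiableOn ℂ L (Metric.ball 0 (R / 2)) →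
      (∀ w ∈ Metric.ball 0 (R / 2), h w = h 0 *
        Complex.exp (L w - ∑ n ∈ H.indices R, weierstrassQ m (w / a n)) *
          ∏' n, weierstrassE m (w / a n)) → ∀ k,
      iteratedDeriv (k + 1) (fun w => L w - ∑ n ∈ H.indices R, weierstrassQ m (w / a n)) 0 =
        iteratedDeriv k (logDeriv h) 0 - iteratedDeriv (k + 1) η 0 := by
    intro R hR L hL hfac k
    have hball : Metric.ball (0 : ℂ) (R / 2) ∈ 𝓝 0 := Metric.ball_mem_nhds _ (by positivity)
    set G : ℂ → ℂ := fun w => L w - ∑ n ∈ H.indices R, weierstrassQ m (w / a n) with hG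
    have hQ : Differentiable ℂ fun w => ∑ n ∈ H.indices R, weierstrassQ m (w / a n) := by
      refine Differentiable.fun_sum fun n _ => ?_
      exact (differentiable_weierstrassQ m).comp (by fun_prop)
    have hGa : AnalyticAt ℂ G 0 := (hL.analyticAt hball).sub (hQ.analyticAt 0)
    have heq : h =ᶠ[𝓝 0] fun w => h 0 * Complex.exp (G w + η w) := by
      filter_upwards [hball, hηP] with w hw hP
      rw [hfac w hw, hP, mul_assoc, ← Complex.exp_add]
    have hlog : logDeriv h =ᶠ[𝓝 0] deriv (G + η) := by
      filter_upwards [heq.eventuallyEq_nhds, hGa.eventually_analyticAt,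
        hη.eventually_analyticAt] with w hw hGw hηw
      have hd : DifferentiableAt ℂ (G + η) w := (hGw.add hηw).differentiableAt
      have h1 : HasDerivAt (fun w => h 0 * Complex.exp (G w + η w))
          (h 0 * (Complex.exp (G w + η w) * deriv (G + η) w)) w :=
        (hd.hasDerivAt.cexp).const_mul _
      rw [logDeriv_apply, hw.deriv_eq, hw.eq_of_nhds, h1.deriv]
      field_simp [H.apply_zero_ne, Complex.exp_ne_zero]
    rw [hlog.iteratedDeriv_eq, ← iteratedDeriv_succ', iteratedDeriv_add hGa.contDiffAt hη.contDiffAt]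
    ring
  -- Above degree `m` the polynomials `Q_m` contribute nothing, and the bound on `L` gives `O(R ^ m
  -- / R ^ (k + 1))`; now `R` is free to grow.
  have hvanish : ∀ k, m ≤ k → iteratedDeriv k (logDeriv h) 0 - iteratedDeriv (k + 1) η 0 = 0 := by
    intro k hk
    rw [← norm_le_zero_iff]
    refine nonpos_of_forall_le_div (C := (k + 1).factorial * (2 * D) * 4 ^ (k + 1)) fun R hR => ?_
    have hR0 : 0 < R := by linarith
    obtain ⟨L, hL, hL0, hre, hfac⟩ := hloc R hR
    have hball : Metric.ball (0 : ℂ) (R / 2) ∈ 𝓝 0 := Metric.ball_mem_nhds _ (by positivity)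
    have hQd : ∀ n, ContDiff ℂ (k + 1 : ℕ) fun w => weierstrassQ m (w / a n) := fun n =>
      ((differentiable_weierstrassQ m).comp (by fun_prop)).contDiff
    rw [← hcoef R hR L hL hfac, iteratedDeriv_fun_sub (hL.analyticAt hball).contDiffAt
      (ContDiff.sum fun n _ => hQd n).contDiffAt, iteratedDeriv_fun_sum fun n _ => (hQd n).contDiffAt,
      Finset.sum_eq_zero fun n _ => iteratedDeriv_weierstrassQ_eq_zero (by omega) _, sub_zero]
    refine (norm_iteratedDeriv_le_of_re_le (by positivity) (by positivity) hL hL0 hre _).trans ?_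
    have h1 : R ^ m * R ≤ R ^ (k + 1) := by
      rw [← pow_succ]; exact pow_le_pow_right₀ hR (by omega)
    rw [div_div, div_pow, div_div_eq_mul_div, div_le_div_iff₀ (by positivity) hR0]
    norm_num
    calc ((k + 1).factorial : ℝ) * (2 * (D * R ^ m)) * 4 ^ (k + 1) * R
        = (k + 1).factorial * (2 * D) * 4 ^ (k + 1) * (R ^ m * R) := by ring
      _ ≤ _ := by gcongr
  set R : ℝ := 2 * (‖w‖ + 1) with hR
  have hR1 : 1 ≤ R := by linarith [norm_nonneg w]
  obtain ⟨L, hL, hL0, hre, hfac⟩ := hloc R hR1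
  have hw : w ∈ Metric.ball (0 : ℂ) (R / 2) := by
    rw [mem_ball_zero_iff, hR]; linarith
  rw [hfac w hw]
  congr 3
  have hQ : Differentiable ℂ fun w => ∑ n ∈ H.indices R, weierstrassQ m (w / a n) := by
    refine Differentiable.fun_sum fun n _ => ?_
    exact (differentiable_weierstrassQ m).comp (by fun_prop)
  have htaylor := Complex.taylorSeries_eq_on_ball' hw (hL.sub hQ.differentiableOn)
  simp only [Pi.sub_apply, sub_zero] at htaylor
  rw [← htaylor, tsum_eq_sum (s := Finset.range (m + 1)), Finset.sum_range_succ', hadamardExponent]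
  · have h0 : (L - fun w => ∑ n ∈ H.indices R, weierstrassQ m (w / a n)) 0 = 0 := by
      simp [hL0, weierstrassQ_zero]
    rw [iteratedDeriv_zero, h0, mul_zero, zero_mul, add_zero]
    refine Finset.sum_congr rfl fun k hk => ?_
    have := hcoef R hR1 L hL hfac k
    -- In degrees up to `m` the product drops out, so `logDeriv h` alone determines the coefficient.
    rw [hηk (k + 1) (by have := Finset.mem_range.1 hk; omega), sub_zero] at this
    rw [← this]
    rfl
  · intro k hk
    rw [Finset.mem_range, not_lt] at hk
    obtain ⟨j, rfl⟩ : ∃ j, k = j + 1 := ⟨k - 1, by omega⟩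
    have := hcoef R hR1 L hL hfac j
    rw [hvanish j (by omega)] at this
    have h2 : iteratedDeriv (j + 1)
      (L - fun w => ∑ n ∈ H.indices R, weierstrassQ m (w / a n)) 0 = 0 := this
    rw [h2, mul_zero, zero_mul]

end IsZeroListing

/-! ### Uniformity and holomorphy in the value `c` -/

lemma HasFiniteOrder.exists_norm_sub_le {f : ℂ → ℂ} (hord : HasFiniteOrder f)
    (hf : Differentiable ℂ f) : ∃ N : ℕ, ∀ c : ℂ, ∃ B : ℝ, 0 ≤ B ∧
      ∀ R : ℝ, 1 ≤ R → ∀ w, ‖w‖ ≤ R → ‖f w - c‖ ≤ Real.exp (B * R ^ N) := by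
  obtain ⟨ρ, hρ⟩ := hord
  obtain ⟨C, hC0, hC⟩ := hρ.exists_pos
  rw [IsBigOWith, Metric.cobounded_eq_cocompact.symm, Filter.HasBasis.eventually_iff
    (Metric.hasBasis_cobounded_compl_closedBall 0)] at hC
  obtain ⟨r, -, hr⟩ := hC
  obtain ⟨K, hK⟩ := (isCompact_closedBall (0 : ℂ) (max r 1)).exists_bound_of_continuousOn
    hf.continuous.continuousOn
  have hK0 : 0 ≤ K := (norm_nonneg _).trans (hK 0 (by simp))
  obtain ⟨N, hN⟩ := exists_nat_ge ρ
  refine ⟨N, fun c => ⟨K + ‖c‖ + C + 1, by positivity, fun R hR w hw => ?_⟩⟩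
  have hRN : 1 ≤ R ^ N := one_le_pow₀ hR
  have hE : 1 ≤ Real.exp (R ^ N) := Real.one_le_exp (by positivity)
  have h1 : ‖f w‖ ≤ K + C * Real.exp (R ^ N) := by
    by_cases h : ‖w‖ ≤ max r 1
    · have := hK w (by simpa using h)
      nlinarith
    · have hrw : r < ‖w‖ ∧ 1 < ‖w‖ := by simpa [not_le, max_lt_iff] using h
      have h2 := hr (show w ∈ (Metric.closedBall 0 r)ᶜ by simpa using hrw.1)
      rw [Real.norm_of_nonneg (Real.exp_pos _).le] at h2
      have h3 : ‖w‖ ^ ρ ≤ R ^ N := by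
        calc ‖w‖ ^ ρ ≤ ‖w‖ ^ (N : ℝ) := Real.rpow_le_rpow_of_exponent_le hrw.2.le hN
          _ = ‖w‖ ^ N := Real.rpow_natCast _ _
          _ ≤ R ^ N := by gcongr
      have h4 : C * Real.exp (‖w‖ ^ ρ) ≤ C * Real.exp (R ^ N) := by gcongr
      linarith
  have hs : 0 ≤ K + ‖c‖ + C := by positivity
  calc ‖f w - c‖ ≤ ‖f w‖ + ‖c‖ := norm_sub_le _ _
    _ ≤ (K + ‖c‖ + C) * Real.exp (R ^ N) := by nlinarith [norm_nonneg c]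
    _ ≤ Real.exp (K + ‖c‖ + C) * Real.exp (R ^ N) := by
      gcongr
      linarith [Real.add_one_le_exp (K + ‖c‖ + C)]
    _ = Real.exp (K + ‖c‖ + C + R ^ N) := by rw [← Real.exp_add]
    _ ≤ _ := by
      rw [Real.exp_le_exp]
      nlinarith

/-- Iterated partial derivatives of a jointly analytic function are jointly analytic. -/
lemma AnalyticOnNhd.exists_iteratedDeriv_fst {Φ : ℂ × ℂ → ℂ} {V : Set (ℂ × ℂ)} (hV : IsOpen V)
    (hΦ : AnalyticOnNhd ℂ Φ V) (k : ℕ) :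
    ∃ Ψ : ℂ × ℂ → ℂ, AnalyticOnNhd ℂ Ψ V ∧
      ∀ p ∈ V, iteratedDeriv k (fun w => Φ (w, p.2)) p.1 = Ψ p := by
  induction k with
  | zero => exact ⟨Φ, hΦ, fun p _ => rfl⟩
  | succ k ih =>
    obtain ⟨Ψ, hΨ, heq⟩ := ih
    refine ⟨fun p => fderiv ℂ Ψ p (1, 0), fun p hp => ?_, fun p hp => ?_⟩
    · exact ((ContinuousLinearMap.apply ℂ ℂ ((1 : ℂ), (0 : ℂ))).analyticAt _).comp (hΨ.fderiv p hp)
    · rw [iteratedDeriv_succ]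
      have hcont : ContinuousAt (fun w : ℂ => (w, p.2)) p.1 := by fun_prop
      have hev : iteratedDeriv k (fun w => Φ (w, p.2)) =ᶠ[𝓝 p.1] fun w => Ψ (w, p.2) := by
        filter_upwards [hcont.eventually_mem (hV.mem_nhds hp)] with w hw
        exact heq (w, p.2) hw
      rw [hev.deriv_eq]
      have h1 : HasFDerivAt Ψ (fderiv ℂ Ψ p) (p.1, p.2) :=
        (hΨ p hp).differentiableAt.hasFDerivAt
      have h2 : HasDerivAt (fun w : ℂ => (w, p.2)) ((1 : ℂ), (0 : ℂ)) p.1 :=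
        (hasDerivAt_id _).prodMk (hasDerivAt_const _ _)
      exact (h1.comp_hasDerivAt p.1 h2).deriv

/-- `f' w / (f w - c)` is jointly analytic off the zeros of its denominator. Its derivatives in `w`
remain so, and `(0, c)` lies in this domain because `c ≠ f 0`. -/
lemma differentiableAt_iteratedDeriv_logDeriv_sub {f : ℂ → ℂ} (hf : Differentiable ℂ f) (k : ℕ)
    {c : ℂ} (hc : c ≠ f 0) :
    DifferentiableAt ℂ (fun c => iteratedDeriv k (logDeriv fun w => f w - c) 0) c := by
  set V : Set (ℂ × ℂ) := {p | f p.1 - p.2 ≠ 0}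
  have hV : IsOpen V := by
    have := hf.continuous
    exact isOpen_ne_fun (by fun_prop) continuous_const
  have hΦ : AnalyticOnNhd ℂ (fun p : ℂ × ℂ => deriv f p.1 / (f p.1 - p.2)) V := by
    intro p hp
    have h1 : AnalyticAt ℂ f p.1 := hf.analyticAt _
    exact (h1.deriv.comp analyticAt_fst).div
      ((h1.comp analyticAt_fst).sub analyticAt_snd) hp
  obtain ⟨Ψ, hΨ, heq⟩ := hΦ.exists_iteratedDeriv_fst hV k
  have hmem : ∀ c ≠ f 0, ((0 : ℂ), c) ∈ V := fun c hc => sub_ne_zero.2 (Ne.symm hc)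
  have hev : (fun c => iteratedDeriv k (logDeriv fun w => f w - c) 0) =ᶠ[𝓝 c]
      fun c => Ψ (0, c) := by
    filter_upwards [isOpen_ne.mem_nhds hc] with c hc
    rw [← heq _ (hmem c hc)]
    congr 1
    ext w
    rw [logDeriv_apply, deriv_sub_const]
  refine DifferentiableAt.congr_of_eventuallyEq ?_ hev
  exact DifferentiableAt.fun_comp' c (hΨ _ (hmem c hc)).differentiableAt (by fun_prop)

lemma differentiableOn_hadamardExponent_sub {f : ℂ → ℂ} (hf : Differentiable ℂ f) (m : ℕ) :
    DifferentiableOn ℂ (fun p : ℂ × ℂ => hadamardExponent m (fun w => f w - p.2) p.1)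
      (univ ×ˢ {f 0}ᶜ) := by
  unfold hadamardExponent
  refine DifferentiableOn.fun_sum fun k _ => fun p hp => DifferentiableAt.differentiableWithinAt ?_
  have h1 : DifferentiableAt ℂ
      (fun p : ℂ × ℂ => iteratedDeriv k (logDeriv fun w => f w - p.2) 0) p :=
    DifferentiableAt.fun_comp' p (differentiableAt_iteratedDeriv_logDeriv_sub hf k hp.2)
      differentiableAt_snd
  fun_prop

lemma IsAutomorphicSystem.isZeroListing {ι : Type} {f : ℂ → ℂ} {Ω : Set ℂ} {φ : ι → ℂ → ℂ}
    (H : IsAutomorphicSystem f Ω φ) (hf : Differentiable ℂ f) {z : ℂ} (hz : z ∈ Ω)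
    (hz0 : f z ≠ f 0) : IsZeroListing (fun w => f w - f z) fun n => φ n z where
  differentiable := hf.sub_const _
  apply_zero_ne := sub_ne_zero.2 hz0.symm
  encard_fiber := H.complete z hz

theorem theorem1 (f : ℂ → ℂ) (hf : Differentiable ℂ f) (hconst : ¬ ∃ c : ℂ, ∀ z, f z = c)
    (hord : HasFiniteOrder f) :
    ∃ (lam : ℕ) (expF P : ℂ × ℂ → ℂ),
      -- `expF` is holomorphic and zero-free on `ℂ × (f(ℂ) \ {f(0)})` ...
      DifferentiableOn ℂ expF (univ ×ˢ (range f \ {f 0})) ∧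
      (∀ p ∈ (univ : Set ℂ) ×ˢ (range f \ {f 0}), expF p ≠ 0) ∧
      -- ... and is the exponential of a holomorphic `F` over simply connected open sets
      (∀ U : Set ℂ, IsOpen U → U ⊆ range f \ {f 0} → IsSimplyConnected U →
        ∃ F : ℂ × ℂ → ℂ, DifferentiableOn ℂ F (univ ×ˢ U) ∧
          ∀ p ∈ (univ : Set ℂ) ×ˢ U, Complex.exp (F p) = expF p) ∧
      -- the canonical product is a holomorphic function `P` of `(w, f(z))`
      DifferentiableOn ℂ P (univ ×ˢ (range f \ {f 0})) ∧
      -- convergence of the product, and the expansion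
      ∀ (ι : Type) (Ω : Set ℂ) (φ : ι → ℂ → ℂ), IsAutomorphicSystem f Ω φ →
        ∀ z ∈ Ω, f z ≠ f 0 →
          HasProdLocallyUniformlyOn (fun (n : ι) (w : ℂ) => weierstrassE lam (w / φ n z))
            (fun w => P (w, f z)) univ ∧
          ∀ w : ℂ, f w - f z =
            expF (w, f z) * ∏' n : ι, weierstrassE lam (w / φ n z) := by
  obtain ⟨N, hN⟩ := hord.exists_norm_sub_le hf
  set m := N + 2
  set X : ℂ × ℂ → ℂ := fun p => hadamardExponent m (fun w => f w - p.2) p.1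
  have hsub : (univ : Set ℂ) ×ˢ (range f \ {f 0}) ⊆ univ ×ˢ {f 0}ᶜ :=
    prod_mono subset_rfl fun c hc => hc.2
  have hX : DifferentiableOn ℂ X (univ ×ˢ (range f \ {f 0})) :=
    (differentiableOn_hadamardExponent_sub hf m).mono hsub
  have hE : DifferentiableOn ℂ (fun p : ℂ × ℂ => (f 0 - p.2) * Complex.exp (X p))
      (univ ×ˢ (range f \ {f 0})) :=
    DifferentiableOn.mul (by fun_prop) hX.cexp
  have hne : ∀ p ∈ (univ : Set ℂ) ×ˢ (range f \ {f 0}),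
      (f 0 - p.2) * Complex.exp (X p) ≠ 0 := fun p hp =>
    mul_ne_zero (sub_ne_zero.2 fun h => hp.2.2 h.symm) (Complex.exp_ne_zero _)
  refine ⟨m, fun p => (f 0 - p.2) * Complex.exp (X p),
    fun p => (f p.1 - p.2) / ((f 0 - p.2) * Complex.exp (X p)), hE, hne, ?_, ?_, ?_⟩
  · intro U hU hUsub hUsc
    -- The exponent `X` is already single-valued, so only the factor `f 0 - c` needs a branch of the
    -- logarithm.
    obtain ⟨l, hl, hlexp⟩ := exists_differentiableOn_log hU hUsc (g := fun c => f 0 - c)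
      (by fun_prop) fun c hc => sub_ne_zero.2 fun h => (hUsub hc).2 h.symm
    refine ⟨fun p => l p.2 + X p, ?_, fun p hp => ?_⟩
    · refine DifferentiableOn.add ?_ (hX.mono (prod_mono subset_rfl hUsub))
      exact hl.comp differentiableOn_snd fun p hp => hp.2
    · rw [Complex.exp_add, hlexp p.2 hp.2]
  · simp only [div_eq_mul_inv]
    refine DifferentiableOn.mul ?_ (hE.inv hne)
    have : Differentiable ℂ fun p : ℂ × ℂ => f p.1 := hf.comp differentiable_fst
    fun_prop
  · intro ι Ω φ hφ z hz hz0
    have H := hφ.isZeroListing hf hz hz0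
    obtain ⟨B, hB0, hB⟩ := hN (f z)
    have hs := H.summable_inv_pow hB
    have hfac := H.hadamard_factorization hB0 hs fun R hR w hw => (hB R hR w hw).trans (by
      rw [Real.exp_le_exp]
      gcongr
      omega)
    have hnez : ∀ w, (f 0 - f z) * Complex.exp (X (w, f z)) ≠ 0 := fun w =>
      hne (w, f z) ⟨mem_univ _, mem_range_self z, hz0⟩
    refine ⟨?_, hfac⟩
    have hprod := hasProdLocallyUniformlyOn_weierstrassE (H.summable_inv_pow_succ hs)
      H.finite_norm_le
    -- The factorization identifies the product with a quotient that involves `z` only through `f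
    -- z`, whatever the enumeration of the zeros.
    have hP : (fun w => (f w - f z) / ((f 0 - f z) * Complex.exp (X (w, f z)))) =
        fun w => ∏' n, weierstrassE m (w / φ n z) := by
      ext w
      rw [div_eq_iff (hnez w), mul_comm]
      exact hfac w
    simpa only [hP] using hprod
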